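/- A forest of rooted trees on $[n]=\{1,\dots,n\}$ is a disjoint union of rooted trees (its components) with total vertex set $[n]$. Each edge $ij$ joins a parent $i$ to its child $j$ (so the path from the root of the tree to $j$ passes through $i$); a vertex $d$ is a descendant of $j$ if the path from the root to $d$ passes through $j$ (in particular, $j$ is a descendant of itself). The edge from the parent $i$ to the child $j$ is called improper if some descendant $d$ of $j$ satisfies $d<i$, and proper otherwise. For $n,k,m\ge 0$ let $f_{n,k,m}$ be the number of forests of rooted trees on $[n]$ with $k$ components and $m$ improper edges, and put, with indeterminates $x,y,z$, $$f_{n,k}(y,z)=\sum_{m=0}^{n-k} f_{n,k,m}\,y^m z^{n-k-m},\qquad F_n(x,y,z)=\sum_{\ell=0}^n f_{n,\ell}(y,z)\,x^\ell,\qquad F_{n,k}(x,y,z)=\sum_{\ell=k}^n f_{n,\ell}(y,z)\binom{\ell}{k}x^{\ell-k},$$ where empty sums are $0$. A matrix of polynomials with integer coefficients, with rows and columns indexed by $0,1,2,\dots$, is coefficientwise totally positive if all its minors (of all finite sizes) are polynomials with nonnegative coefficients. A sequence $(a_n)_{n\ge0}$ of polynomials is coefficientwise Hankel-totally positive if the infinite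 Hankel matrix $(a_{n+n'})_{n,n'\ge 0}$ is coefficientwise totally positive. Theorem 1.3. (a) The matrix $F(x,y,z)=\bigl(F_{n,k}(x,y,z)\bigr)_{n,k\ge0}$ is unit-lower-triangular (entries $1$ on the diagonal and $0$ above it) and is coefficientwise totally positive, jointly in $x,y,z$. (b) The sequence $\bigl(F_n(x,y,z)\bigr)_{n\ge0}$ is coefficientwise Hankel-totally positive, jointly in $x,y,z$. (c) The sequence $\bigl(f_{n+1,1}(y,z)\bigr)_{n\ge0}$ of homogenized Ramanujan polynomials is coefficientwise Hankel-totally positive, jointly in $y,z$. -/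

import Mathlib

/-- A forest of rooted trees on the vertex set `V`: each vertex has at most one parent
(the roots are the vertices without parent), and every vertex is reached from some root by going
down finitely many times from a parent to a child. -/
@[ext]
structure RootedForest (V : Type*) where
  /-- the parent of a vertex, `none` for a root -/
  parent : V → Option V
  exists_root : ∀ j : V, ∃ r : V, parent r = none ∧
    Relation.ReflTransGen (fun a b : V => parent b = some a) r j

namespace RootedForest

variable {V : Type*}

/-- `i` is the parent of `j`: the forest has the edge `ij`, directed away from the root. -/
def IsEdge (F : RootedForest V) (i j : V) : Prop :=
  F.parent j = some i

/-- `j` is a descendant of `i`; every vertex is a descendant of itself. -/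
def IsDescendant (F : RootedForest V) (i j : V) : Prop :=
  Relation.ReflTransGen F.IsEdge i j

/-- The edge from the parent `i` to its child `j` is improper if some descendant of `j`
(possibly `j` itself) is lower-numbered than `i`. All other edges are proper. -/
def IsImproperEdge [LT V] (F : RootedForest V) (i j : V) : Prop :=
  F.IsEdge i j ∧ ∃ d : V, F.IsDescendant j d ∧ d < i

/-- The number of components (trees), which is the number of roots. -/
noncomputable def numComponents (F : RootedForest V) : ℕ :=
  {r : V | F.parent r = none}.ncard

/-- The number of improper edges. -/
noncomputable def numImproper [LT V] (F : RootedForest V) : ℕ :=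
  {e : V × V | F.IsImproperEdge e.1 e.2}.ncard

instance [Finite V] : Finite (RootedForest V) :=
  Finite.of_injective RootedForest.parent fun _ _ h => RootedForest.ext h

end RootedForest

/-- `f_{n,k,m}`: the number of forests of rooted trees on a totally ordered set of `n` labeled
vertices that have `k` components and `m` improper edges. -/
noncomputable def forestCount (n k m : ℕ) : ℕ :=
  Nat.card {F : RootedForest (Fin n) // F.numComponents = k ∧ F.numImproper = m}

/-- `f_{n,k}(y,z) = ∑_{m=0}^{n-k} f_{n,k,m} y^m z^{n-k-m}`, at elements `y, z` of a commutative
ring. For `k > n` the value is `0`, since there are no forests with more components than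
vertices. -/
noncomputable def forestPoly {R : Type*} [CommRing R] (y z : R) (n k : ℕ) : R :=
  ∑ m ∈ Finset.range (n - k + 1), (forestCount n k m : R) * y ^ m * z ^ (n - k - m)

/-- The row-generating polynomial `F_n(x,y,z) = ∑_{ℓ=0}^n f_{n,ℓ}(y,z) x^ℓ`. -/
noncomputable def rowPoly {R : Type*} [CommRing R] (x y z : R) (n : ℕ) : R :=
  ∑ l ∈ Finset.range (n + 1), forestPoly y z n l * x ^ l

/-- The binomial row-generating matrix, with entries
`F_{n,k}(x,y,z) = ∑_{ℓ=k}^n f_{n,ℓ}(y,z) (ℓ choose k) x^{ℓ-k}`. -/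
noncomputable def binomialRowMatrix {R : Type*} [CommRing R] (x y z : R) : Matrix ℕ ℕ R :=
  Matrix.of fun n k => ∑ l ∈ Finset.Icc k n, forestPoly y z n l * (l.choose k : R) * x ^ (l - k)

/-- Entries `1` on the diagonal and `0` above it. -/
def IsUnitLowerTriangular {R : Type*} [CommRing R] (A : Matrix ℕ ℕ R) : Prop :=
  (∀ n, A n n = 1) ∧ ∀ n k, n < k → A n k = 0

/-- A matrix of polynomials is coefficientwise totally positive if all its minors (of all finite
sizes, with rows and columns taken in increasing order) have nonnegative coefficients. -/
def CoeffwiseTP {σ : Type*} (A : Matrix ℕ ℕ (MvPolynomial σ ℤ)) : Prop :=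
  ∀ (r : ℕ) (I J : Fin r → ℕ), StrictMono I → StrictMono J →
    ∀ d : σ →₀ ℕ, 0 ≤ (A.submatrix I J).det.coeff d

/-- A sequence of polynomials is coefficientwise Hankel-totally positive if its infinite Hankel
matrix `(a_{i+j})_{i,j ≥ 0}` is coefficientwise totally positive. -/
def CoeffwiseHankelTP {σ : Type*} (a : ℕ → MvPolynomial σ ℤ) : Prop :=
  CoeffwiseTP (Matrix.of fun i j => a (i + j))

/-!
The row polynomials `f_n(X) = ∑_F y^(improper edges) z^(proper edges) X^(components)` of forests on
`n` vertices satisfy a recurrence that is read off by inserting a new minimal vertex `0`.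

* If `0` is a root of a forest `G`, deleting `0` leaves a forest on the other vertices together with
  the set of those of its roots that were children of `0`, by proper edges. Such `G` contribute
  `X * f_n(X + z)` (`RootedForest.sum_parent_zero_eq_none`).
* If `0` is not a root, the first edge of the path from its root `r` to `0` is improper, since `0`
  is the minimal vertex. Cutting it gives a forest with one more component and a marked root `r`
  of a tree that does not contain `0`, and any such pair arises once; the status of the other
  edges does not change. If `X * h(X)` denotes the contribution of all `G`, the contribution of
  these is `X * y * h'(X)` (`RootedForest.sum_parent_zero_ne_none`).

So `h = f_n(X + z) + y h'`, that is, `f_(n+1) = X * (1 - y d/dX)⁻¹ f_n(X + z)`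
(`RootedForest.genPoly_succ_eq`).

The entries `F_{n,k}` are the coefficients of `f_n(X + x)`. Translations commute with `d/dX`, so
`f_n(X + x) = φ^n 1` for the operator `φ p = (X + x) * (1 - y d/dX)⁻¹ p(X + z)` (`taylor_genPoly`).
In the basis of monomials its three factors have totally positive matrices: multiplication by
`X + x` is bidiagonal, the matrix of a translation has the rows `(X + z)^n`, which are iterates of
such a multiplication, and the matrix of the resolvent is a product of elementary bidiagonal
matrices. By the Cauchy–Binet formula `φ` has a totally positive matrix. Again by Cauchy–Binet, the
coefficients of `φ^n 1` then form a totally positive matrix (`isTP_coeff_iterate`), and the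
constant terms of `φ^n 1` a Hankel-totally positive sequence (`isTP_hankel_iterate`): these are (a)
and (b). For (c), `f_(n+1) = X * χ^n 1` with `χ p` the image of `X * p` under the translation and the
resolvent, so `f_{n+1,1}` is the constant term of `χ^n 1`.

Total positivity is treated relative to a subsemiring `S` of a commutative ring, whose elements
play the role of nonnegative ones; in the end `S` consists of the integer polynomials with
nonnegative coefficients.
-/

/-! ### The Cauchy–Binet formula -/

/-- The **Cauchy–Binet formula**: the determinant of a product of an `r × n` and an `n × r` matrix
is the sum of the products of corresponding `r × r` minors. -/
theorem Matrix.det_mul_eq_sum_strictMono {R n : Type*} [CommRing R] [Fintype n] [LinearOrder n]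
    {r : ℕ} (A : Matrix (Fin r) n R) (B : Matrix n (Fin r) R)
    [DecidablePred fun e : Fin r → n => StrictMono e] :
    (A * B).det = ∑ e : Fin r → n with StrictMono e,
      (A.submatrix id e).det * (B.submatrix e id).det := by
  have h1 : (A * B).det = ∑ f : Fin r → n, (∏ i, A i (f i)) * (B.submatrix f id).det := by
    have : (A * B) = fun i => ∑ j, A i j • B j := by
      ext i k
      simp [Matrix.mul_apply, Finset.sum_apply]
    rw [this]
    change Matrix.detRowAlternating.toMultilinearMap (fun i => ∑ j, A i j • B j) = _
    rw [MultilinearMap.map_sum]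
    refine Finset.sum_congr rfl fun f _ => ?_
    rw [MultilinearMap.map_smul_univ, smul_eq_mul]
    rfl
  have h2 : ∀ f : Fin r → n, ¬ Function.Injective f →
      (∏ i, A i (f i)) * (B.submatrix f id).det = 0 := by
    intro f hf
    obtain ⟨i, j, hij, hne⟩ : ∃ i j, f i = f j ∧ i ≠ j := by
      simpa [Function.Injective] using hf
    rw [Matrix.det_zero_of_row_eq hne (by ext k; simp [hij]), mul_zero]
  have h3 : ∀ e : Fin r → n, (A.submatrix id e).det * (B.submatrix e id).det =
      ∑ σ : Equiv.Perm (Fin r), (∏ i, A i (e (σ i))) * (B.submatrix (e ∘ σ) id).det := by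
    intro e
    rw [← Matrix.det_transpose, Matrix.det_apply', Finset.sum_mul]
    refine Finset.sum_congr rfl fun σ _ => ?_
    have : B.submatrix (e ∘ σ) id = (B.submatrix e id).submatrix σ id := by
      ext; simp
    rw [this, Matrix.det_permute]
    simp only [Matrix.transpose_apply, Matrix.submatrix_apply, id]
    ring
  classical
  rw [h1, ← Finset.sum_filter_of_ne (p := Function.Injective)
    (fun f _ hf => by by_contra h; exact hf (h2 f h))]
  simp_rw [h3]
  rw [← Finset.sum_product']
  symm
  -- every injective tuple is uniquely a strictly increasing tuple composed with a permutation
  refine Finset.sum_nbij (fun p : (Fin r → n) × Equiv.Perm (Fin r) => p.1 ∘ p.2) ?_ ?_ ?_ ?_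
  · rintro ⟨e, σ⟩ h
    simp only [Finset.mem_product, Finset.mem_filter, Finset.mem_univ, true_and, and_true] at h ⊢
    exact h.injective.comp σ.injective
  · rintro ⟨e, σ⟩ h ⟨e', σ'⟩ h' heq
    simp only [Finset.coe_product, Set.mem_prod, Finset.mem_coe, Finset.mem_filter,
      Finset.mem_univ, true_and, and_true] at h h' heq
    have hr : Set.range e = Set.range e' := by
      rw [← σ.surjective.range_comp e, heq, σ'.surjective.range_comp e']
    have he : e = e' := (StrictMono.range_inj h h').1 hr
    subst he
    have : σ = σ' := by
      ext i
      have := h.injective (congrFun heq i)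
      rw [this]
    rw [this]
  · intro f hf
    simp only [Finset.coe_filter, Finset.mem_univ, true_and, Set.mem_ofPred_eq] at hf
    refine ⟨(f ∘ Tuple.sort f, (Tuple.sort f)⁻¹), ?_, ?_⟩
    · simp only [Finset.coe_product, Set.mem_prod, Finset.mem_coe, Finset.mem_filter,
        Finset.mem_univ, true_and, and_true]
      exact (Tuple.monotone_sort f).strictMono_of_injective
        (hf.comp (Tuple.sort f).injective)
    · ext i
      simp
  · rintro ⟨e, σ⟩ _
    rfl

/-- A determinant whose first row vanishes outside the corner. -/
theorem Matrix.det_eq_of_row_zero {R : Type*} [CommRing R] {r : ℕ}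
    (M : Matrix (Fin (r + 1)) (Fin (r + 1)) R) (h : ∀ j : Fin r, M 0 j.succ = 0) :
    M.det = M 0 0 * (M.submatrix Fin.succ Fin.succ).det := by
  rw [Matrix.det_succ_row_zero, Fin.sum_univ_succ]
  simp [h]

/-! ### Total positivity relative to a subsemiring -/

section TotalPositivity

variable {R : Type*} [CommRing R] {S : Subsemiring R}

/-- All minors of `A` whose rows are among the first `m` rows lie in the subsemiring `S` (of
elements regarded as nonnegative). -/
def TPBelow (S : Subsemiring R) (m : ℕ) (A : Matrix ℕ ℕ R) : Prop :=
  ∀ (r : ℕ) (I J : Fin r → ℕ), StrictMono I → StrictMono J → (∀ i, I i < m) →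
    (A.submatrix I J).det ∈ S

/-- Total positivity relative to a subsemiring `S`: all minors of `A` lie in `S`. -/
def IsTP (S : Subsemiring R) (A : Matrix ℕ ℕ R) : Prop :=
  ∀ (r : ℕ) (I J : Fin r → ℕ), StrictMono I → StrictMono J → (A.submatrix I J).det ∈ S

theorem isTP_of_forall_below {A : Matrix ℕ ℕ R} (h : ∀ m, TPBelow S m A) : IsTP S A :=
  fun r I J hI hJ => h (Finset.univ.sup I + 1) r I J hI hJ fun i =>
    Nat.lt_succ_of_le (Finset.le_sup (f := I) (Finset.mem_univ i))

theorem IsTP.below {A : Matrix ℕ ℕ R} (h : IsTP S A) (m : ℕ) : TPBelow S m A :=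
  fun r I J hI hJ _ => h r I J hI hJ

theorem IsTP.transpose {A : Matrix ℕ ℕ R} (h : IsTP S A) : IsTP S A.transpose := by
  intro r I J hI hJ
  rw [← Matrix.det_transpose]
  exact h r J I hJ hI

theorem tpBelow_zero (A : Matrix ℕ ℕ R) : TPBelow S 0 A := by
  intro r I J _ _ h
  cases r with
  | zero => simp
  | succ r => exact absurd (h 0) (Nat.not_lt_zero _)

/-- `C` is the product of the infinite matrices `A` and `B`, each entry being given by a sum that
has only finitely many nonzero terms: its partial sums are eventually equal to the entry. -/
def IsMatrixProd (A B C : Matrix ℕ ℕ R) : Prop :=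
  ∀ n k, ∃ N₀, ∀ N ≥ N₀, C n k = ∑ j ∈ Finset.range N, A n j * B j k

theorem TPBelow.mul {m : ℕ} {A B C : Matrix ℕ ℕ R} (hA : TPBelow S m A) (hB : IsTP S B)
    (h : IsMatrixProd A B C) : TPBelow S m C := by
  classical
  intro r I J hI hJ hm
  choose N₀ hN₀ using h
  let N := Finset.univ.sup fun p : Fin r × Fin r => N₀ (I p.1) (J p.2)
  have hC : C.submatrix I J =
      A.submatrix I (fun j : Fin N => (j : ℕ)) * B.submatrix (fun j : Fin N => (j : ℕ)) J := by
    ext i j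
    rw [Matrix.submatrix_apply, hN₀ (I i) (J j) N
      (Finset.le_sup (f := fun p : Fin r × Fin r => N₀ (I p.1) (J p.2)) (Finset.mem_univ (i, j))),
      Matrix.mul_apply, Finset.sum_range]
    rfl
  rw [hC, Matrix.det_mul_eq_sum_strictMono]
  refine sum_mem fun e he => mul_mem ?_ ?_
  · exact hA r I (fun i => e i) hI (Fin.val_strictMono.comp (Finset.mem_filter.1 he).2) hm
  · exact hB r (fun i => e i) J (Fin.val_strictMono.comp (Finset.mem_filter.1 he).2) hJ

theorem IsTP.mul {A B C : Matrix ℕ ℕ R} (hA : IsTP S A) (hB : IsTP S B)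
    (h : IsMatrixProd A B C) : IsTP S C :=
  isTP_of_forall_below fun m => (hA.below m).mul hB h

/-- Matrices with nonnegative entries supported on the diagonal and the subdiagonal are totally
positive. -/
theorem isTP_of_bidiagonal {A : Matrix ℕ ℕ R} (hS : ∀ n k, A n k ∈ S)
    (h0 : ∀ n k, k ≠ n → k + 1 ≠ n → A n k = 0) : IsTP S A := by
  intro r
  induction r with
  | zero => intros; simp
  | succ r ih =>
    intro I J hI hJ
    have key : (A.submatrix I J).det =
        A (I 0) (J 0) * (A.submatrix (I ∘ Fin.succ) (J ∘ Fin.succ)).det := by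
      -- in the first row or in the first column only the corner entry can be nonzero
      rcases le_or_gt (I 0) (J 0) with h | h
      · rw [Matrix.det_eq_of_row_zero]
        · rfl
        · intro j
          have := hJ (Fin.succ_pos j)
          exact h0 _ _ (by omega) (by omega)
      · rw [← Matrix.det_transpose, Matrix.det_eq_of_row_zero, ← Matrix.det_transpose]
        · rfl
        · intro j
          have := hI (Fin.succ_pos j)
          exact h0 _ _ (by omega) (by omega)
    rw [key]
    exact mul_mem (hS _ _) (ih _ _ (hI.comp (Fin.strictMono_succ)) (hJ.comp (Fin.strictMono_succ)))

/-- The matrix `A` with the row `(1, 0, 0, …)` put on top. -/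
def consRow (A : Matrix ℕ ℕ R) : Matrix ℕ ℕ R
  | 0, k => if k = 0 then 1 else 0
  | n + 1, k => A n k

/-- The block diagonal matrix `1 ⊕ A`. -/
def oneSum (A : Matrix ℕ ℕ R) : Matrix ℕ ℕ R
  | 0, 0 => 1
  | 0, _ + 1 => 0
  | _ + 1, 0 => 0
  | n + 1, k + 1 => A n k

@[simp] theorem consRow_zero (A : Matrix ℕ ℕ R) (k : ℕ) :
    consRow A 0 k = if k = 0 then 1 else 0 := rfl

@[simp] theorem consRow_succ (A : Matrix ℕ ℕ R) (n k : ℕ) : consRow A (n + 1) k = A n k := rfl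

@[simp] theorem oneSum_zero_zero (A : Matrix ℕ ℕ R) : oneSum A 0 0 = 1 := rfl

@[simp] theorem oneSum_zero_succ (A : Matrix ℕ ℕ R) (k : ℕ) : oneSum A 0 (k + 1) = 0 := rfl

@[simp] theorem oneSum_succ_zero (A : Matrix ℕ ℕ R) (n : ℕ) : oneSum A (n + 1) 0 = 0 := rfl

@[simp] theorem oneSum_succ_succ (A : Matrix ℕ ℕ R) (n k : ℕ) :
    oneSum A (n + 1) (k + 1) = A n k := rfl

theorem strictMono_pred {r : ℕ} {I : Fin r → ℕ} (hI : StrictMono I) (h : ∀ i, 0 < I i) :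
    StrictMono fun i => I i - 1 := by
  intro i j hij
  have := hI hij
  have := h i
  simp only
  omega

theorem consRow_minor_of_pos {A : Matrix ℕ ℕ R} (hA : IsTP S A) {r : ℕ} {I J : Fin r → ℕ}
    (hI : StrictMono I) (hJ : StrictMono J) (h : ∀ i, 0 < I i) :
    ((consRow A).submatrix I J).det ∈ S := by
  have : (consRow A).submatrix I J = A.submatrix (fun i => I i - 1) J := by
    ext i j
    obtain ⟨a, ha⟩ := Nat.exists_eq_succ_of_ne_zero (h i).ne'
    simp [ha]
  rw [this]
  exact hA r _ J (strictMono_pred hI h) hJ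

theorem isTP_consRow {A : Matrix ℕ ℕ R} (hA : IsTP S A) : IsTP S (consRow A) := by
  intro r I J hI hJ
  cases r with
  | zero => simp
  | succ r =>
    rcases Nat.eq_zero_or_pos (I 0) with h | h
    · rw [Matrix.det_eq_of_row_zero]
      · refine mul_mem ?_ (consRow_minor_of_pos hA (hI.comp Fin.strictMono_succ)
          (hJ.comp Fin.strictMono_succ) fun i => ?_)
        · simp only [Matrix.submatrix_apply, h, consRow_zero]
          split_ifs <;> simp
        · exact (Nat.zero_le _).trans_lt (hI (Fin.succ_pos i))
      · intro j
        have := hJ (Fin.succ_pos j)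
        simp only [Matrix.submatrix_apply, h, consRow_zero]
        rw [if_neg (by omega)]
    · exact consRow_minor_of_pos hA hI hJ fun i => h.trans_le (hI.monotone (Fin.zero_le i))

theorem oneSum_minor_of_pos {m : ℕ} {A : Matrix ℕ ℕ R} (hA : TPBelow S m A) {r : ℕ}
    {I J : Fin r → ℕ} (hI : StrictMono I) (hJ : StrictMono J) (hm : ∀ i, I i < m + 1)
    (h : ∀ i, 0 < I i) (h' : ∀ i, 0 < J i) : ((oneSum A).submatrix I J).det ∈ S := by
  have : (oneSum A).submatrix I J = A.submatrix (fun i => I i - 1) (fun i => J i - 1) := by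
    ext i j
    obtain ⟨a, ha⟩ := Nat.exists_eq_succ_of_ne_zero (h i).ne'
    obtain ⟨b, hb⟩ := Nat.exists_eq_succ_of_ne_zero (h' j).ne'
    simp [ha, hb]
  rw [this]
  refine hA r _ _ (strictMono_pred hI h) (strictMono_pred hJ h') fun i => ?_
  have := h i
  have := hm i
  omega

theorem tpBelow_oneSum {m : ℕ} {A : Matrix ℕ ℕ R} (hA : TPBelow S m A) :
    TPBelow S (m + 1) (oneSum A) := by
  intro r I J hI hJ hm
  cases r with
  | zero => simp
  | succ r =>
    have hI' : ∀ i : Fin r, 0 < I i.succ := fun i => (Nat.zero_le _).trans_lt (hI (Fin.succ_pos i))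
    have hJ' : ∀ i : Fin r, 0 < J i.succ := fun i => (Nat.zero_le _).trans_lt (hJ (Fin.succ_pos i))
    rcases Nat.eq_zero_or_pos (I 0) with h | h
    · rw [Matrix.det_eq_of_row_zero]
      · refine mul_mem ?_ (oneSum_minor_of_pos hA (hI.comp Fin.strictMono_succ)
          (hJ.comp Fin.strictMono_succ) (fun i => hm _) hI' hJ')
        rcases Nat.eq_zero_or_pos (J 0) with h2 | h2
        · simp [h, h2]
        · obtain ⟨b, hb⟩ := Nat.exists_eq_succ_of_ne_zero h2.ne'
          simp [h, hb]
      · intro j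
        obtain ⟨b, hb⟩ := Nat.exists_eq_succ_of_ne_zero (hJ' j).ne'
        simp [h, hb]
    · have hIpos : ∀ i, 0 < I i := fun i => h.trans_le (hI.monotone (Fin.zero_le i))
      rcases Nat.eq_zero_or_pos (J 0) with h2 | h2
      · rw [Matrix.det_eq_zero_of_column_eq_zero 0]
        · exact zero_mem S
        · intro i
          obtain ⟨a, ha⟩ := Nat.exists_eq_succ_of_ne_zero (hIpos i).ne'
          simp [ha, h2]
      · exact oneSum_minor_of_pos hA hI hJ hm hIpos fun i =>
          h2.trans_le (hJ.monotone (Fin.zero_le i))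

/-- If the row `0` of `O` is `(1, 0, 0, …)` and each further row is the preceding one times `P`,
then `O` (the output matrix of the production matrix `P`) inherits total positivity from `P`. -/
theorem IsTP.output {P O : Matrix ℕ ℕ R} (hP : IsTP S P) (h0 : ∀ k, O 0 k = if k = 0 then 1 else 0)
    (hs : ∀ n k, ∃ N₀, ∀ N ≥ N₀, O (n + 1) k = ∑ j ∈ Finset.range N, O n j * P j k) :
    IsTP S O := by
  -- the factorization `O = (1 ⊕ O) * consRow P` expresses each row through earlier rows of `O`
  have hprod : IsMatrixProd (oneSum O) (consRow P) O := by
    rintro (_ | n) k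
    · refine ⟨1, fun N hN => ?_⟩
      obtain ⟨N, rfl⟩ := Nat.exists_eq_add_of_le' hN
      rw [Finset.sum_range_succ']
      simp [h0]
    · obtain ⟨N₀, h⟩ := hs n k
      refine ⟨N₀ + 1, fun N hN => ?_⟩
      obtain ⟨N, rfl⟩ := Nat.exists_eq_add_of_le' (le_trans (Nat.le_add_left 1 N₀) hN)
      rw [Finset.sum_range_succ', h N (by omega)]
      simp
  refine isTP_of_forall_below fun m => ?_
  induction m with
  | zero => exact tpBelow_zero O
  | succ m ih => exact (tpBelow_oneSum ih).mul (isTP_consRow hP) hprod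

/-- The lower triangular matrix whose `(n, k)` entry is `a k * a (k + 1) * ⋯ * a (n - 1)`. -/
def chainMatrix (a : ℕ → R) : Matrix ℕ ℕ R :=
  Matrix.of fun n k => if k ≤ n then ∏ i ∈ Finset.Ico k n, a i else 0

/-- The elementary bidiagonal matrix with `1` on the diagonal and `c` at position `(1, 0)`. -/
def elemMatrix (c : R) : Matrix ℕ ℕ R :=
  Matrix.of fun n k => (if n = k then 1 else 0) + if n = 1 ∧ k = 0 then c else 0

theorem isMatrixProd_chainMatrix (a : ℕ → R) :
    IsMatrixProd (oneSum (chainMatrix fun i => a (i + 1))) (elemMatrix (a 0)) (chainMatrix a) := by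
  intro n k
  refine ⟨k + 2, fun N hN => ?_⟩
  have h1 : ∑ j ∈ Finset.range N, oneSum (chainMatrix fun i => a (i + 1)) n j *
      elemMatrix (a 0) j k = oneSum (chainMatrix fun i => a (i + 1)) n k +
        if k = 0 then oneSum (chainMatrix fun i => a (i + 1)) n 1 * a 0 else 0 := by
    simp only [elemMatrix, Matrix.of_apply, mul_add, Finset.sum_add_distrib]
    congr 1
    · simp only [mul_ite, mul_one, mul_zero, Finset.sum_ite_eq', Finset.mem_range]
      rw [if_pos (by omega)]
    · by_cases hk : k = 0
      · simp only [hk, and_true, mul_ite, mul_zero, Finset.sum_ite_eq', Finset.mem_range, if_true]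
        rw [if_pos (by omega)]
      · simp [hk]
  rw [h1]
  have hIco : ∀ p q : ℕ, ∏ i ∈ Finset.Ico (p + 1) (q + 1), a i = ∏ i ∈ Finset.Ico p q, a (i + 1) :=
    fun p q => (Finset.prod_Ico_add' a p q 1).symm
  rcases n with _ | n <;> rcases k with _ | k
  · simp [chainMatrix]
  · simp [chainMatrix]
  · simp only [chainMatrix, Matrix.of_apply, Nat.zero_le, if_true, oneSum_succ_zero,
      oneSum_succ_succ, zero_add]
    rw [Finset.prod_eq_prod_Ico_succ_bot (Nat.succ_pos n), hIco, mul_comm]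
  · simp [chainMatrix, hIco]

theorem isTP_chainMatrix {a : ℕ → R} (ha : ∀ i, a i ∈ S) : IsTP S (chainMatrix a) := by
  refine isTP_of_forall_below fun m => ?_
  induction m generalizing a with
  | zero => exact tpBelow_zero _
  | succ m ih =>
    refine (tpBelow_oneSum (ih fun i => ha (i + 1))).mul (isTP_of_bidiagonal ?_ ?_)
      (isMatrixProd_chainMatrix a)
    · intro n k
      refine add_mem ?_ ?_ <;> split_ifs
      · exact one_mem S
      · exact zero_mem S
      · exact ha 0
      · exact zero_mem S
    · intro n k h1 h2
      simp only [elemMatrix, Matrix.of_apply]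
      rw [if_neg (by omega), if_neg (by omega), add_zero]

end TotalPositivity

/-! ### Totally positive operators on polynomials -/

section Operators

open Polynomial

variable {R : Type*} [CommRing R] {S : Subsemiring R}

/-- The matrix of an `R`-linear operator on `R[X]`: row `n` lists the coefficients of the image
of `X ^ n`. With this convention composition of operators is the reversed matrix product. -/
noncomputable def opMatrix (φ : R[X] →ₗ[R] R[X]) : Matrix ℕ ℕ R :=
  Matrix.of fun n k => (φ (X ^ n)).coeff k

theorem coeff_linearMap_eq_sum {M : Type*} [AddCommGroup M] [Module R M] (φ : R[X] →ₗ[R] M)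
    (p : R[X]) {N : ℕ} (hN : p.natDegree < N) :
    φ p = ∑ j ∈ Finset.range N, p.coeff j • φ (X ^ j) := by
  conv_lhs => rw [p.as_sum_range' N hN]
  rw [map_sum]
  refine Finset.sum_congr rfl fun j _ => ?_
  rw [← map_smul, smul_X_eq_monomial]

theorem isTP_opMatrix_comp {φ ψ : R[X] →ₗ[R] R[X]} (hφ : IsTP S (opMatrix φ))
    (hψ : IsTP S (opMatrix ψ)) : IsTP S (opMatrix (ψ ∘ₗ φ)) := by
  refine hφ.mul hψ fun n k => ⟨(φ (X ^ n)).natDegree + 1, fun N hN => ?_⟩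
  simp only [opMatrix, Matrix.of_apply, LinearMap.comp_apply]
  rw [coeff_linearMap_eq_sum ψ _ (Nat.lt_of_succ_le hN), finsetSum_coeff]
  simp

/-- The coefficients of the iterates `φ^n 1` form a totally positive matrix if the matrix of `φ`
is totally positive. -/
theorem isTP_coeff_iterate {φ : R[X] →ₗ[R] R[X]} (hφ : IsTP S (opMatrix φ)) :
    IsTP S (Matrix.of fun n k => (φ^[n] 1).coeff k) := by
  refine hφ.output (fun k => ?_) fun n k => ⟨(φ^[n] 1).natDegree + 1, fun N hN => ?_⟩
  · simp [coeff_one]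
  · simp only [opMatrix, Matrix.of_apply, Function.iterate_succ_apply']
    rw [coeff_linearMap_eq_sum φ _ (Nat.lt_of_succ_le hN), finsetSum_coeff]
    simp

/-- The constant terms of the iterates `φ^n 1` form a Hankel-totally positive sequence if the
matrix of `φ` is totally positive. -/
theorem isTP_hankel_iterate {φ : R[X] →ₗ[R] R[X]} (hφ : IsTP S (opMatrix φ)) :
    IsTP S (Matrix.of fun m n => (φ^[m + n] 1).coeff 0) := by
  -- the Hankel matrix is the product of the matrix of coefficients of `φ^m 1` and the
  -- matrix of constant terms of `φ^n (X ^ k)`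
  have hdual : IsTP S (Matrix.of fun n k => (φ^[n] (X ^ k)).coeff 0) := by
    refine hφ.transpose.output (fun k => ?_)
      fun n k => ⟨(φ (X ^ k)).natDegree + 1, fun N hN => ?_⟩
    · simp [coeff_X_pow, eq_comm]
    · simp only [opMatrix, Matrix.of_apply, Matrix.transpose_apply, Function.iterate_succ_apply]
      rw [← Module.End.coe_pow, coeff_linearMap_eq_sum (φ ^ n) _ (Nat.lt_of_succ_le hN),
        finsetSum_coeff]
      simp [mul_comm]
  refine (isTP_coeff_iterate hφ).mul hdual.transpose
    fun m n => ⟨(φ^[m] 1).natDegree + 1, fun N hN => ?_⟩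
  simp only [Matrix.of_apply, Matrix.transpose_apply]
  rw [add_comm, Function.iterate_add_apply, ← Module.End.coe_pow φ n,
    coeff_linearMap_eq_sum (φ ^ n) _ (Nat.lt_of_succ_le hN), finsetSum_coeff]
  simp

theorem isTP_opMatrix_mulLeft_X_add_C {c : R} (hc : c ∈ S) :
    IsTP S (opMatrix (LinearMap.mulLeft R (X + C c))) := by
  have h : ∀ n k, opMatrix (LinearMap.mulLeft R (X + C c)) n k =
      (if k = n + 1 then 1 else 0) + if k = n then c else 0 := by
    intro n k
    simp [opMatrix, add_mul, ← pow_succ', coeff_X_pow]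
  refine (isTP_of_bidiagonal (S := S)
    (A := (opMatrix (LinearMap.mulLeft R (X + C c))).transpose) ?_ ?_).transpose
  · intro n k
    rw [Matrix.transpose_apply, h]
    refine add_mem ?_ ?_ <;> split_ifs <;> simp [hc]
  · intro n k h1 h2
    rw [Matrix.transpose_apply, h, if_neg (by omega), if_neg (by omega), add_zero]

theorem isTP_opMatrix_taylor {c : R} (hc : c ∈ S) : IsTP S (opMatrix (taylor c)) := by
  have h := isTP_coeff_iterate (isTP_opMatrix_mulLeft_X_add_C hc)
  convert h using 1
  ext n k
  simp only [opMatrix, Matrix.of_apply, taylor_X_pow]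
  congr 1
  induction n with
  | zero => simp
  | succ n ih => rw [Function.iterate_succ_apply', ← ih, pow_succ']; simp

/-- The polynomial `∑ₖ n!/k! y^(n-k) X^k`, the image of `X ^ n` under `(1 - y d/dX)⁻¹`. -/
noncomputable def derivResolventPoly (y : R) : ℕ → R[X]
  | 0 => 1
  | n + 1 => X ^ (n + 1) + C ((n + 1 : R) * y) * derivResolventPoly y n

/-- The operator `(1 - y d/dX)⁻¹ = ∑ᵢ y^i (d/dX)^i` on polynomials. -/
noncomputable def derivResolvent (y : R) : R[X] →ₗ[R] R[X] :=
  (basisMonomials R).constr R (derivResolventPoly y)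

theorem derivResolvent_X_pow (y : R) (n : ℕ) : derivResolvent y (X ^ n) = derivResolventPoly y n := by
  have := (basisMonomials R).constr_basis R (derivResolventPoly y) n
  rw [derivResolvent]
  simpa only [coe_basisMonomials, monomial_one_right_eq_X_pow] using this

theorem coeff_derivResolventPoly (y : R) (n k : ℕ) :
    (derivResolventPoly y n).coeff k = chainMatrix (fun i => (i + 1 : R) * y) n k := by
  induction n with
  | zero => rcases k with _ | k <;> simp [derivResolventPoly, chainMatrix, coeff_one]
  | succ n ih =>
    rw [derivResolventPoly, coeff_add, coeff_C_mul, ih, coeff_X_pow]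
    simp only [chainMatrix, Matrix.of_apply]
    rcases lt_trichotomy k (n + 1) with h | h | h
    · rw [if_neg (by omega), if_pos (by omega), if_pos (by omega),
        Finset.prod_Ico_succ_top (by omega)]
      ring
    · subst h
      simp
    · rw [if_neg (by omega), if_neg (by omega), if_neg (by omega)]
      simp

theorem isTP_opMatrix_derivResolvent {y : R} (hy : y ∈ S) : IsTP S (opMatrix (derivResolvent y)) := by
  have : opMatrix (derivResolvent y) = chainMatrix fun i => (i + 1 : R) * y := by
    ext n k
    rw [opMatrix, Matrix.of_apply, derivResolvent_X_pow, coeff_derivResolventPoly]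
  rw [this]
  refine isTP_chainMatrix fun i => mul_mem ?_ hy
  exact add_mem (natCast_mem S i) (one_mem S)

theorem derivResolvent_sub_derivative (y : R) (p : R[X]) :
    derivResolvent y (p - C y * derivative p) = p := by
  have : derivResolvent y ∘ₗ (LinearMap.id - y • derivative) = LinearMap.id := by
    refine (basisMonomials R).ext fun n => ?_
    simp only [coe_basisMonomials, monomial_one_right_eq_X_pow, LinearMap.comp_apply,
      LinearMap.sub_apply, LinearMap.id_apply, LinearMap.smul_apply, map_sub, map_smul,
      derivative_X_pow, derivResolvent_X_pow]
    rcases n with _ | n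
    · simp [derivResolventPoly]
    · rw [← smul_eq_C_mul, map_smul, Nat.add_sub_cancel, derivResolvent_X_pow]
      simp only [derivResolventPoly, smul_eq_C_mul, C_mul, Nat.cast_add, Nat.cast_one]
      ring
  have := LinearMap.congr_fun this p
  simpa [smul_eq_C_mul] using this

theorem derivResolvent_sub_derivative_derivResolvent (y : R) (p : R[X]) :
    derivResolvent y p - C y * derivative (derivResolvent y p) = p := by
  have h : ∀ n, derivResolventPoly y n - C y * derivative (derivResolventPoly y n) = X ^ n := by
    intro n
    induction n with
    | zero => simp [derivResolventPoly]
    | succ n ih =>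
      simp only [derivResolventPoly, derivative_add, derivative_C_mul, derivative_X_pow,
        Nat.add_sub_cancel]
      rw [← ih]
      simp only [C_mul, Nat.cast_add, Nat.cast_one]
      ring
  have : (LinearMap.id - y • derivative) ∘ₗ derivResolvent y = LinearMap.id := by
    refine (basisMonomials R).ext fun n => ?_
    simp only [coe_basisMonomials, monomial_one_right_eq_X_pow, LinearMap.comp_apply,
      LinearMap.sub_apply, LinearMap.id_apply, LinearMap.smul_apply, derivResolvent_X_pow]
    rw [smul_eq_C_mul, h]
  have := LinearMap.congr_fun this p
  simpa [smul_eq_C_mul] using this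

theorem derivative_taylor_comm (x : R) (p : R[X]) :
    derivative (taylor x p) = taylor x (derivative p) := by
  simp [taylor_apply, derivative_comp]

/-- Translations commute with `d/dX`, hence with its resolvent. -/
theorem derivResolvent_taylor (x y : R) (p : R[X]) :
    derivResolvent y (taylor x p) = taylor x (derivResolvent y p) := by
  conv_lhs => rw [← derivResolvent_sub_derivative_derivResolvent y p]
  rw [map_sub, taylor_mul, taylor_C, ← derivative_taylor_comm, derivResolvent_sub_derivative]

end Operators

/-! ### Rooted forests and their parent functions -/

namespace RootedForest

section Basic

variable {V : Type*}

theorem wellFounded_isEdge (F : RootedForest V) : WellFounded F.IsEdge := by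
  refine ⟨fun j => ?_⟩
  obtain ⟨r, hr, h⟩ := F.exists_root j
  induction h with
  | refl => exact ⟨_, fun i hi => by simp [IsEdge, hr] at hi⟩
  | @tail b c _ hbc ih =>
    refine ⟨_, fun i hi => ?_⟩
    obtain rfl : b = i := Option.some_injective _ (hbc.symm.trans hi)
    exact ih

/-- A parent function is that of a forest as soon as its parent–child relation is well-founded. -/
def ofWellFounded (p : V → Option V) (h : WellFounded fun a b : V => p b = some a) :
    RootedForest V where
  parent := p
  exists_root := fun j => by
    induction j using h.induction with
    | _ j ih =>
      cases hj : p j with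
      | none => exact ⟨j, hj, .refl⟩
      | some i =>
        obtain ⟨r, hr, hri⟩ := ih i hj
        exact ⟨r, hr, hri.tail hj⟩

theorem IsDescendant.eq_of_parent_eq_none {F : RootedForest V} {i j : V} (h : F.IsDescendant i j)
    (hj : F.parent j = none) : i = j := by
  rcases Relation.ReflTransGen.cases_tail h with h | ⟨b, _, hb⟩
  · exact h.symm
  · simp [IsEdge, hj] at hb

theorem IsDescendant.eq_or_of_isEdge {F : RootedForest V} {a i j : V} (h : F.IsDescendant a j)
    (hj : F.IsEdge i j) : a = j ∨ F.IsDescendant a i := by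
  rcases Relation.ReflTransGen.cases_tail h with h | ⟨b, hab, hb⟩
  · exact Or.inl h.symm
  · obtain rfl : b = i := Option.some_injective _ (hb.symm.trans hj)
    exact Or.inr hab

/-- Every vertex lies in exactly one tree. -/
theorem existsUnique_root (F : RootedForest V) (j : V) :
    ∃! r, F.parent r = none ∧ F.IsDescendant r j := by
  obtain ⟨r, hr, h⟩ := F.exists_root j
  refine ⟨r, ⟨hr, h⟩, ?_⟩
  rintro s ⟨hs, hsj⟩
  induction h with
  | refl => exact hsj.eq_of_parent_eq_none hr
  | @tail b c _ hbc ih =>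
    rcases hsj.eq_or_of_isEdge hbc with h | h
    · subst h
      simp [hs] at hbc
    · exact ih h

/-- The path from the root to a vertex that is not a root has exactly one first edge. -/
theorem existsUnique_first_edge (F : RootedForest V) (j : V) (hj : F.parent j ≠ none) :
    ∃! e : V × V, F.parent e.1 = none ∧ F.IsEdge e.1 e.2 ∧ F.IsDescendant e.2 j := by
  induction j using F.wellFounded_isEdge.induction with
  | _ j ih =>
    obtain ⟨i, hi⟩ := Option.ne_none_iff_exists'.1 hj
    by_cases hroot : F.parent i = none
    · refine ⟨(i, j), ⟨hroot, hi, .refl⟩, ?_⟩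
      rintro ⟨r, v⟩ ⟨hr, hrv, hv⟩
      rcases hv.eq_or_of_isEdge hi with h | h
      · obtain rfl : v = j := h
        obtain rfl : r = i := Option.some_injective _ (hrv.symm.trans hi)
        rfl
      · obtain rfl : v = i := h.eq_of_parent_eq_none hroot
        simp [IsEdge, hroot] at hrv
    · obtain ⟨⟨r, v⟩, ⟨hr, hrv, hv⟩, huniq⟩ := ih i hi hroot
      refine ⟨(r, v), ⟨hr, hrv, hv.tail hi⟩, ?_⟩
      rintro ⟨s, w⟩ ⟨hs, hsw, hw⟩
      rcases hw.eq_or_of_isEdge hi with h | h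
      · obtain rfl : w = j := h
        obtain rfl : s = i := Option.some_injective _ (hsw.symm.trans hi)
        exact absurd hs hroot
      · exact huniq _ ⟨hs, hsw, h⟩

theorem numImproper_add_numComponents_le [Fintype V] [LT V] (F : RootedForest V) :
    F.numImproper + F.numComponents ≤ Fintype.card V := by
  have h1 : F.numImproper ≤ {r : V | F.parent r = none}ᶜ.ncard := by
    refine Set.ncard_le_ncard_of_injOn Prod.snd ?_ ?_ (Set.toFinite _)
    · rintro ⟨i, j⟩ ⟨h, _⟩
      simp only [IsEdge] at h
      simp [h]
    · rintro ⟨i, j⟩ ⟨h, _⟩ ⟨i', j'⟩ ⟨h', _⟩ (hj : j = j')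
      subst hj
      simp only [IsEdge] at h h'
      rw [h] at h'
      simpa using h'
  have h2 := Set.ncard_add_ncard_compl {r : V | F.parent r = none}
  rw [Nat.card_eq_fintype_card] at h2
  unfold numComponents
  omega

end Basic

/-! ### Cutting the first edge on the path to the minimal vertex -/

section Cut

variable {V : Type*} [DecidableEq V]

/-- Make the root `v` a child of `r`, another root. -/
def attach (F : RootedForest V) (r v : V) (hr : F.parent r = none) (hrv : r ≠ v) :
    RootedForest V :=
  ofWellFounded (Function.update F.parent v (some r)) <| by
    have hacc_r : Acc (fun a b => Function.update F.parent v (some r) b = some a) r :=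
      ⟨_, fun a ha => by simp [Function.update_of_ne hrv, hr] at ha⟩
    refine ⟨fun j => ?_⟩
    induction j using F.wellFounded_isEdge.induction with
    | _ j ih =>
      refine ⟨_, fun i hi => ?_⟩
      by_cases hj : j = v
      · subst hj
        simp only [Function.update_self, Option.some.injEq] at hi
        exact hi ▸ hacc_r
      · rw [Function.update_of_ne hj] at hi
        exact ih i hi

/-- Delete the edge that leads to `v`, making `v` a root. -/
def cut (F : RootedForest V) (v : V) : RootedForest V :=
  ofWellFounded (Function.update F.parent v none) <| by
    refine Subrelation.wf (fun {a b} hab => ?_) F.wellFounded_isEdge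
    by_cases hb : b = v
    · subst hb
      simp at hab
    · rwa [Function.update_of_ne hb] at hab

theorem attach_parent (F : RootedForest V) (r v : V) (hr hrv) :
    (F.attach r v hr hrv).parent = Function.update F.parent v (some r) := rfl

theorem cut_parent (F : RootedForest V) (v : V) :
    (F.cut v).parent = Function.update F.parent v none := rfl

theorem cut_attach (F : RootedForest V) (r v : V) (hr hrv) (hv : F.parent v = none) :
    (F.attach r v hr hrv).cut v = F := by
  ext1
  rw [cut_parent, attach_parent, Function.update_idem, ← hv, Function.update_eq_self]

theorem attach_cut (F : RootedForest V) (r v : V) (hr hrv) (hv : F.parent v = some r) :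
    (F.cut v).attach r v hr hrv = F := by
  ext1
  rw [attach_parent, cut_parent, Function.update_idem, ← hv, Function.update_eq_self]

variable {F : RootedForest V} {r v : V}

theorem isEdge_attach (hr : F.parent r = none) (hrv : r ≠ v) (hv : F.parent v = none) (i j : V) :
    (F.attach r v hr hrv).IsEdge i j ↔ (i = r ∧ j = v) ∨ F.IsEdge i j := by
  unfold IsEdge
  rw [attach_parent]
  by_cases hj : j = v
  · subst hj
    simp [hv, eq_comm]
  · simp [hj]

/-- Attaching a tree below the root `r` changes only the set of descendants of `r`. -/
theorem isDescendant_attach (hr : F.parent r = none) (hrv : r ≠ v) (hv : F.parent v = none)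
    {j : V} (hj : j ≠ r) (d : V) :
    (F.attach r v hr hrv).IsDescendant j d ↔ F.IsDescendant j d := by
  constructor
  · intro h
    induction h with
    | refl => exact .refl
    | tail _ hbc ih =>
      rcases (isEdge_attach hr hrv hv _ _).1 hbc with ⟨rfl, rfl⟩ | h
      · exact absurd (ih.eq_of_parent_eq_none hr) hj
      · exact ih.tail h
  · intro h
    exact Relation.ReflTransGen.mono (fun a b hab => (isEdge_attach hr hrv hv a b).2 (Or.inr hab)) _ _ h

theorem numComponents_attach [Finite V] (hr : F.parent r = none) (hrv : r ≠ v)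
    (hv : F.parent v = none) :
    (F.attach r v hr hrv).numComponents + 1 = F.numComponents := by
  have : {a : V | F.parent a = none} =
      insert v {a : V | (F.attach r v hr hrv).parent a = none} := by
    ext a
    by_cases ha : a = v
    · simp [ha, hv]
    · simp [attach_parent, ha]
  unfold numComponents
  rw [this, Set.ncard_insert_of_notMem _ (Set.toFinite _)]
  simp [attach_parent]

/-- The edge on which a tree containing the minimal vertex is attached is improper. -/
theorem numImproper_attach [Finite V] [LinearOrder V] {b : V} (hb : ∀ a, b ≤ a)
    (hr : F.parent r = none) (hrv : r ≠ v) (hv : F.parent v = none) (hvb : F.IsDescendant v b) :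
    (F.attach r v hr hrv).numImproper = F.numImproper + 1 := by
  have hne : ∀ {i j}, F.IsEdge i j → j ≠ r := by
    rintro i j h rfl
    simp [IsEdge, hr] at h
  have : {e : V × V | (F.attach r v hr hrv).IsImproperEdge e.1 e.2} =
      insert (r, v) {e : V × V | F.IsImproperEdge e.1 e.2} := by
    ext ⟨i, j⟩
    simp only [Set.mem_ofPred_eq, Set.mem_insert_iff, Prod.mk.injEq]
    unfold IsImproperEdge
    rw [isEdge_attach hr hrv hv]
    constructor
    · rintro ⟨h | h, d, hd, hdi⟩
      · exact Or.inl h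
      · exact Or.inr ⟨h, d, (isDescendant_attach hr hrv hv (hne h) d).1 hd, hdi⟩
    · rintro (⟨rfl, rfl⟩ | ⟨h, d, hd, hdi⟩)
      · refine ⟨Or.inl ⟨rfl, rfl⟩, b, (isDescendant_attach hr hrv hv hrv.symm b).2 hvb,
          lt_of_le_of_ne (hb _) ?_⟩
        rintro rfl
        exact hrv (hvb.eq_of_parent_eq_none hr).symm
      · exact ⟨Or.inr h, d, (isDescendant_attach hr hrv hv (hne h) d).2 hd, hdi⟩
  unfold numImproper
  rw [this, Set.ncard_insert_of_notMem _ (Set.toFinite _)]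
  simp [IsImproperEdge, IsEdge, hv]

end Cut

/-! ### Deleting the minimal vertex when it is a root -/

section AddMin

variable {n : ℕ}

open Classical in
/-- Add a new minimal vertex `0` as a root, and make the roots in `T` its children; the old
vertices are shifted by `Fin.succ`. -/
noncomputable def addMin (F : RootedForest (Fin n)) (T : Finset (Fin n)) :
    RootedForest (Fin (n + 1)) :=
  ofWellFounded
    (Fin.cases none fun j => if j ∈ T then some 0 else (F.parent j).map Fin.succ) <| by
    refine ⟨fun j => ?_⟩
    have h0 : Acc (fun a b : Fin (n + 1) => (Fin.cases none
        fun j => if j ∈ T then some 0 else (F.parent j).map Fin.succ : Fin (n + 1) →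
          Option (Fin (n + 1))) b = some a) 0 := ⟨_, fun a ha => by simp at ha⟩
    induction j using Fin.cases with
    | zero => exact h0
    | succ j =>
      induction j using F.wellFounded_isEdge.induction with
      | _ j ih =>
        refine ⟨_, fun i hi => ?_⟩
        simp only [Fin.cases_succ] at hi
        split_ifs at hi
        · exact Option.some_injective _ hi ▸ h0
        · obtain ⟨a, ha, rfl⟩ := Option.map_eq_some_iff.1 hi
          exact ih a ha

/-- Delete the vertex `0`; its children become roots. -/
def removeMin (G : RootedForest (Fin (n + 1))) : RootedForest (Fin n) :=
  ofWellFounded (fun j => (G.parent j.succ).bind (Fin.cases none some)) <| by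
    refine Subrelation.wf (fun {a b} hab => ?_)
      (InvImage.wf (Fin.succ : Fin n → Fin (n + 1)) G.wellFounded_isEdge)
    obtain ⟨c, hc, hc'⟩ := Option.bind_eq_some_iff.1 hab
    induction c using Fin.cases with
    | zero => simp at hc'
    | succ c =>
      simp only [Fin.cases_succ, Option.some.injEq] at hc'
      exact hc' ▸ hc

variable (F : RootedForest (Fin n)) (T : Finset (Fin n))

@[simp] theorem addMin_parent_zero : (F.addMin T).parent 0 = none := rfl

open Classical in
@[simp] theorem addMin_parent_succ (j : Fin n) :
    (F.addMin T).parent j.succ = if j ∈ T then some 0 else (F.parent j).map Fin.succ := rfl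

theorem removeMin_parent (G : RootedForest (Fin (n + 1))) (j : Fin n) :
    G.removeMin.parent j = (G.parent j.succ).bind (Fin.cases none some) := rfl

theorem removeMin_addMin (hT : ∀ j ∈ T, F.parent j = none) : (F.addMin T).removeMin = F := by
  ext1
  funext j
  rw [removeMin_parent, addMin_parent_succ]
  split_ifs with h
  · simp [hT j h]
  · cases F.parent j <;> simp

theorem addMin_removeMin (G : RootedForest (Fin (n + 1))) (hG : G.parent 0 = none)
    (hT : ∀ j, j ∈ T ↔ G.parent j.succ = some 0) : G.removeMin.addMin T = G := by
  ext1
  funext j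
  induction j using Fin.cases with
  | zero => rw [addMin_parent_zero, hG]
  | succ j =>
    rw [addMin_parent_succ]
    split_ifs with h
    · exact ((hT j).1 h).symm
    · rw [removeMin_parent]
      cases hp : G.parent j.succ with
      | none => rfl
      | some c =>
        induction c using Fin.cases with
        | zero => exact absurd ((hT j).2 hp) h
        | succ c => simp

variable {F T}

theorem isEdge_addMin_succ_succ (hT : ∀ j ∈ T, F.parent j = none) (i j : Fin n) :
    (F.addMin T).IsEdge i.succ j.succ ↔ F.IsEdge i j := by
  unfold IsEdge
  rw [addMin_parent_succ]
  split_ifs with h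
  · simp [hT j h, (Fin.succ_ne_zero i).symm]
  · simp

theorem isDescendant_addMin_succ (hT : ∀ j ∈ T, F.parent j = none) (j : Fin n)
    (d : Fin (n + 1)) :
    (F.addMin T).IsDescendant j.succ d ↔ ∃ d', d = d'.succ ∧ F.IsDescendant j d' := by
  constructor
  · intro h
    induction h with
    | refl => exact ⟨j, rfl, .refl⟩
    | @tail b c _ hbc ih =>
      obtain ⟨b', rfl, hb⟩ := ih
      induction c using Fin.cases with
      | zero => simp [IsEdge] at hbc
      | succ c => exact ⟨c, rfl, hb.tail ((isEdge_addMin_succ_succ hT _ _).1 hbc)⟩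
  · rintro ⟨d', rfl, h⟩
    exact Relation.ReflTransGen.lift Fin.succ
      (fun a b hab => (isEdge_addMin_succ_succ hT a b).2 hab) _ _ h

theorem numImproper_addMin (hT : ∀ j ∈ T, F.parent j = none) :
    (F.addMin T).numImproper = F.numImproper := by
  have : {e : Fin (n + 1) × Fin (n + 1) | (F.addMin T).IsImproperEdge e.1 e.2} =
      Prod.map Fin.succ Fin.succ '' {e : Fin n × Fin n | F.IsImproperEdge e.1 e.2} := by
    ext ⟨i, j⟩
    simp only [Set.mem_ofPred_eq, Set.mem_image, Prod.exists, Prod.map_apply, Prod.mk.injEq]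
    constructor
    · rintro ⟨hij, d, hd, hdi⟩
      induction j using Fin.cases with
      | zero => simp [IsEdge] at hij
      | succ j =>
        induction i using Fin.cases with
        | zero => simp at hdi
        | succ i =>
          obtain ⟨d', rfl, hd'⟩ := (isDescendant_addMin_succ hT j d).1 hd
          exact ⟨i, j, ⟨(isEdge_addMin_succ_succ hT i j).1 hij, d', hd', by simpa using hdi⟩,
            rfl, rfl⟩
    · rintro ⟨i, j, ⟨hij, d, hd, hdi⟩, rfl, rfl⟩
      exact ⟨(isEdge_addMin_succ_succ hT i j).2 hij, d.succ,
        (isDescendant_addMin_succ hT j _).2 ⟨d, rfl, hd⟩, by simpa using hdi⟩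
  unfold numImproper
  rw [this, Set.ncard_image_of_injective _
    ((Fin.succ_injective n).prodMap (Fin.succ_injective n))]

theorem numComponents_addMin (hT : ∀ j ∈ T, F.parent j = none) :
    (F.addMin T).numComponents + T.card = F.numComponents + 1 := by
  have h1 : {r : Fin (n + 1) | (F.addMin T).parent r = none} =
      insert 0 (Fin.succ '' ({r : Fin n | F.parent r = none} \ T)) := by
    ext r
    induction r using Fin.cases with
    | zero => simp
    | succ r =>
      simp only [Set.mem_ofPred_eq, addMin_parent_succ, Set.mem_insert_iff, Fin.succ_ne_zero,
        false_or, (Fin.succ_injective n).mem_set_image, Set.mem_sdiff, Finset.mem_coe]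
      split_ifs with h <;> simp [h]
  have h2 : (T : Set (Fin n)) ⊆ {r : Fin n | F.parent r = none} := fun j hj => hT j hj
  have h3 := Set.ncard_sdiff_add_ncard_of_subset h2
  unfold numComponents
  rw [h1, Set.ncard_insert_of_notMem (by simp [Fin.succ_ne_zero]) (Set.toFinite _),
    Set.ncard_image_of_injective _ (Fin.succ_injective n), ← h3, Set.ncard_coe_finset]
  omega

end AddMin

end RootedForest

/-! ### The generating polynomial of forests by number of components -/

namespace RootedForest

open Polynomial

noncomputable instance instFintype {V : Type*} [Finite V] :
    Fintype (RootedForest V) := Fintype.ofFinite _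

section Roots

variable {V : Type*}

/-- The root of the tree that contains `j`. -/
noncomputable def rootOf (F : RootedForest V) (j : V) : V :=
  (F.existsUnique_root j).choose

theorem parent_rootOf (F : RootedForest V) (j : V) : F.parent (F.rootOf j) = none :=
  (F.existsUnique_root j).choose_spec.1.1

theorem isDescendant_rootOf (F : RootedForest V) (j : V) : F.IsDescendant (F.rootOf j) j :=
  (F.existsUnique_root j).choose_spec.1.2

theorem eq_rootOf {F : RootedForest V} {r j : V} (hr : F.parent r = none)
    (h : F.IsDescendant r j) : r = F.rootOf j :=
  (F.existsUnique_root j).choose_spec.2 r ⟨hr, h⟩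

variable [Fintype V]

open Classical in
/-- The set of roots. -/
noncomputable def roots (F : RootedForest V) : Finset V :=
  {r | F.parent r = none}

@[simp] theorem mem_roots {F : RootedForest V} {r : V} : r ∈ F.roots ↔ F.parent r = none := by
  simp [roots]

theorem card_roots (F : RootedForest V) : F.roots.card = F.numComponents := by
  rw [numComponents, ← Set.ncard_coe_finset]
  congr 1
  ext
  simp

end Roots

variable {R : Type*} [CommRing R] (y z : R) {n : ℕ}

/-- The product of `y` over the improper edges and `z` over the proper edges. The subtractions do
not truncate, by `numImproper_add_numComponents_le`. -/
noncomputable def edgeWeight (F : RootedForest (Fin n)) : R :=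
  y ^ F.numImproper * z ^ (n - F.numComponents - F.numImproper)

/-- The generating polynomial of forests on `n` vertices, with `X` marking components. -/
noncomputable def genPoly (n : ℕ) : R[X] :=
  ∑ F : RootedForest (Fin n), C (edgeWeight y z F) * X ^ F.numComponents

theorem genPoly_eq_sum_forestPoly (n : ℕ) :
    genPoly y z n = ∑ l ∈ Finset.range (n + 1), C (forestPoly y z n l) * X ^ l := by
  classical
  have hmaps : ∀ F ∈ (Finset.univ : Finset (RootedForest (Fin n))),
      (⟨F.numComponents, F.numImproper⟩ : Σ _ : ℕ, ℕ) ∈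
        (Finset.range (n + 1)).sigma fun l => Finset.range (n - l + 1) := by
    intro F _
    have := F.numImproper_add_numComponents_le
    rw [Fintype.card_fin] at this
    simp only [Finset.mem_sigma, Finset.mem_range]
    omega
  rw [genPoly, ← Finset.sum_fiberwise_of_maps_to hmaps, Finset.sum_sigma]
  refine Finset.sum_congr rfl fun l _ => ?_
  rw [forestPoly, map_sum, Finset.sum_mul]
  refine Finset.sum_congr rfl fun m _ => ?_
  have hcard : forestCount n l m = (Finset.univ.filter fun F : RootedForest (Fin n) =>
      (⟨F.numComponents, F.numImproper⟩ : Σ _ : ℕ, ℕ) = ⟨l, m⟩).card := by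
    rw [forestCount, Nat.card_eq_fintype_card, Fintype.card_subtype]
    simp
  rw [hcard, Finset.sum_congr rfl (g := fun _ => C (y ^ m * z ^ (n - l - m)) * X ^ l)]
  · rw [Finset.sum_const, nsmul_eq_mul]
    simp only [C_mul, map_natCast]
    ring
  · intro F hF
    simp only [Finset.mem_filter, Finset.mem_univ, true_and, Sigma.mk.injEq, heq_eq_eq] at hF
    rw [edgeWeight, hF.1, hF.2]

/-- The generating polynomial of forests on `n + 1` vertices, with `X` marking the components that
do not contain the vertex `0`. -/
noncomputable def reducedGenPoly (n : ℕ) : R[X] :=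
  ∑ G : RootedForest (Fin (n + 1)), C (edgeWeight y z G) * X ^ (G.numComponents - 1)

theorem numComponents_pos (G : RootedForest (Fin (n + 1))) : 0 < G.numComponents := by
  rw [← card_roots, Finset.card_pos]
  exact ⟨G.rootOf 0, mem_roots.2 (G.parent_rootOf 0)⟩

theorem genPoly_succ (n : ℕ) : genPoly y z (n + 1) = X * reducedGenPoly y z n := by
  rw [genPoly, reducedGenPoly, Finset.mul_sum]
  refine Finset.sum_congr rfl fun G _ => ?_
  obtain ⟨k, hk⟩ := Nat.exists_eq_succ_of_ne_zero G.numComponents_pos.ne'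
  rw [hk, Nat.succ_sub_one, pow_succ]
  ring

/-- Forests in which `0` is a root: each root of the forest on the remaining vertices either
remains a root or becomes a child of `0` along a proper edge, hence the shift `X ↦ X + z`. -/
theorem sum_parent_zero_eq_none [DecidablePred fun G : RootedForest (Fin (n + 1)) =>
      G.parent 0 = none] :
    ∑ G : RootedForest (Fin (n + 1)) with G.parent 0 = none,
      C (edgeWeight y z G) * X ^ (G.numComponents - 1) = taylor z (genPoly y z n) := by
  classical
  have h1 : taylor z (genPoly y z n) = ∑ F : RootedForest (Fin n), ∑ T ∈ F.roots.powerset,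
      C (edgeWeight y z F) * (C z ^ T.card * X ^ (F.numComponents - T.card)) := by
    rw [genPoly, map_sum]
    refine Finset.sum_congr rfl fun F _ => ?_
    rw [← Finset.mul_sum, ← card_roots, Finset.sum_pow_mul_eq_add_pow, taylor_mul, taylor_C,
      taylor_X_pow, add_comm]
  rw [h1, Finset.sum_sigma']
  symm
  refine Finset.sum_bij' (fun p _ => p.1.addMin p.2)
    (fun G _ => ⟨G.removeMin, Finset.univ.filter fun j => G.parent (Fin.succ j) = some 0⟩)
    ?_ ?_ ?_ ?_ ?_
  · rintro ⟨F, T⟩ _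
    simp
  · intro G _
    simp only [Finset.mem_sigma, Finset.mem_univ, true_and, Finset.mem_powerset]
    intro j hj
    simp only [Finset.mem_filter, Finset.mem_univ, true_and] at hj
    simp [removeMin_parent, hj]
  · rintro ⟨F, T⟩ h
    simp only [Finset.mem_sigma, Finset.mem_univ, true_and, Finset.mem_powerset] at h
    have hT : ∀ j ∈ T, F.parent j = none := fun j hj => mem_roots.1 (h hj)
    have : (Finset.univ.filter fun j : Fin n => (F.addMin T).parent j.succ = some 0) = T := by
      ext j
      rw [Finset.mem_filter, addMin_parent_succ]
      split_ifs with hj <;> simp [hj]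
    simp only [removeMin_addMin F T hT, this]
  · intro G hG
    exact addMin_removeMin _ G (by simpa using hG) (by simp)
  · rintro ⟨F, T⟩ h
    simp only [Finset.mem_sigma, Finset.mem_univ, true_and, Finset.mem_powerset] at h
    have hT : ∀ j ∈ T, F.parent j = none := fun j hj => mem_roots.1 (h hj)
    have hc := numComponents_addMin hT
    have hle := Finset.card_le_card h
    have hle' := F.numImproper_add_numComponents_le
    rw [card_roots] at hle
    rw [Fintype.card_fin] at hle'
    simp only [edgeWeight, numImproper_addMin hT]
    rw [show n + 1 - (F.addMin T).numComponents - F.numImproper =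
        n - F.numComponents - F.numImproper + T.card by omega,
      show (F.addMin T).numComponents - 1 = F.numComponents - T.card by omega, pow_add]
    simp only [C_mul, C_pow]
    ring

theorem ne_rootOf_of_mem_erase {V : Type*} [Fintype V] [DecidableEq V] {F : RootedForest V}
    {r j : V} (h : r ∈ F.roots.erase (F.rootOf j)) : F.parent r = none ∧ r ≠ F.rootOf j :=
  ⟨mem_roots.1 (Finset.mem_of_mem_erase h), Finset.ne_of_mem_erase h⟩

/-- Forests in which `0` is not a root: they arise by attaching the tree that contains `0` to the
root of another tree along an improper edge, hence the operator `y d/dX`. -/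
theorem sum_parent_zero_ne_none [DecidablePred fun G : RootedForest (Fin (n + 1)) =>
      ¬ G.parent 0 = none] :
    ∑ G : RootedForest (Fin (n + 1)) with ¬ G.parent 0 = none,
      C (edgeWeight y z G) * X ^ (G.numComponents - 1) =
    C y * derivative (reducedGenPoly y z n) := by
  classical
  -- the exponent produced by the derivative counts the roots of the trees without `0`
  have h1 : C y * derivative (reducedGenPoly y z n) =
      ∑ F : RootedForest (Fin (n + 1)), ∑ _r ∈ F.roots.erase (F.rootOf 0),
        C (y * edgeWeight y z F) * X ^ (F.numComponents - 2) := by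
    rw [reducedGenPoly, derivative_sum, Finset.mul_sum]
    refine Finset.sum_congr rfl fun F _ => ?_
    rw [Finset.sum_const, Finset.card_erase_of_mem (mem_roots.2 (F.parent_rootOf 0)), card_roots,
      derivative_C_mul, derivative_X_pow, nsmul_eq_mul, Nat.sub_sub]
    simp only [C_mul, map_natCast]
    ring
  have hfirst := fun (G : RootedForest (Fin (n + 1)))
    (hG : G ∈ Finset.univ.filter fun G : RootedForest (Fin (n + 1)) => ¬ G.parent 0 = none) =>
      G.existsUnique_first_edge 0 (Finset.mem_filter.1 hG).2
  -- `e G` is the first edge of the path from the root to `0`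
  choose e he huniq using hfirst
  rw [h1, Finset.sum_sigma']
  symm
  have hmem : ∀ p : (Σ _ : RootedForest (Fin (n + 1)), Fin (n + 1)),
      p ∈ Finset.univ.sigma (fun F : RootedForest (Fin (n + 1)) => F.roots.erase (F.rootOf 0)) →
        p.1.parent p.2 = none ∧ p.2 ≠ p.1.rootOf 0 :=
    fun p hp => ne_rootOf_of_mem_erase (Finset.mem_sigma.1 hp).2
  have hne : ∀ (G : RootedForest (Fin (n + 1))) hG, (e G hG).1 ≠ (e G hG).2 := by
    intro G hG h
    obtain ⟨h1, h2, _⟩ := he G hG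
    rw [← h, IsEdge, h1] at h2
    simp at h2
  have hcut : ∀ (G : RootedForest (Fin (n + 1))) hG, (G.cut (e G hG).2).parent (e G hG).1 = none := by
    intro G hG
    rw [cut_parent, Function.update_of_ne (hne G hG)]
    exact (he G hG).1
  -- after cutting the first edge, its lower end is the root of the tree of `0`, and conversely
  -- attaching that tree makes the new edge the first one: the two operations are inverse
  have hroot : ∀ (G : RootedForest (Fin (n + 1))) hG, (e G hG).2 = (G.cut (e G hG).2).rootOf 0 := by
    intro G hG
    have hp : (G.cut (e G hG).2).parent (e G hG).2 = none := by simp [cut_parent]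
    refine eq_rootOf hp ?_
    rw [← isDescendant_attach (hcut G hG) (hne G hG) hp (hne G hG).symm,
      attach_cut _ _ _ _ _ (he G hG).2.1]
    exact (he G hG).2.2
  have hattach : ∀ (p : Σ _ : RootedForest (Fin (n + 1)), Fin (n + 1)) hp hG,
      e (p.1.attach p.2 (p.1.rootOf 0) (hmem p hp).1 (hmem p hp).2) hG =
      (p.2, p.1.rootOf 0) := by
    intro p hp hG
    symm
    refine huniq _ hG _ ⟨?_, ?_, ?_⟩
    · rw [attach_parent, Function.update_of_ne (hmem p hp).2]
      exact (hmem p hp).1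
    · simp [IsEdge, attach_parent]
    · rw [isDescendant_attach _ _ (p.1.parent_rootOf 0) (hmem p hp).2.symm]
      exact p.1.isDescendant_rootOf 0
  have hA : ∀ (p : Σ _ : RootedForest (Fin (n + 1)), Fin (n + 1)) hp,
      p.1.attach p.2 (p.1.rootOf 0) (hmem p hp).1 (hmem p hp).2 ∈
      Finset.univ.filter fun G : RootedForest (Fin (n + 1)) => ¬ G.parent 0 = none := by
    intro p hp
    simp only [Finset.mem_filter, Finset.mem_univ, true_and]
    intro h0
    have := (isDescendant_attach (hmem p hp).1 (hmem p hp).2 (p.1.parent_rootOf 0)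
      (hmem p hp).2.symm 0).2 (p.1.isDescendant_rootOf 0)
    have h := (congrArg (p.1.attach p.2 (p.1.rootOf 0) (hmem p hp).1 (hmem p hp).2).parent
      (this.eq_of_parent_eq_none h0)).trans h0
    simp [attach_parent] at h
  refine Finset.sum_bij'
    (fun p hp => p.1.attach p.2 (p.1.rootOf 0) (hmem p hp).1 (hmem p hp).2)
    (fun G hG => ⟨G.cut (e G hG).2, (e G hG).1⟩) hA ?_ ?_ ?_ ?_
  · intro G hG
    simp only [Finset.mem_sigma, Finset.mem_univ, true_and, Finset.mem_erase, mem_roots]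
    rw [← hroot G hG]
    exact ⟨hne G hG, hcut G hG⟩
  · intro p hp
    have h := hattach p hp (hA p hp)
    simp only [h]
    rw [cut_attach _ _ _ _ _ (p.1.parent_rootOf 0)]
  · intro G hG
    simp only [← hroot G hG]
    exact attach_cut _ _ _ _ _ (he G hG).2.1
  · intro p hp
    obtain ⟨hr, hrv⟩ := hmem p hp
    have hc := numComponents_attach hr hrv (p.1.parent_rootOf 0)
    have hi := numImproper_attach (fun a => Fin.zero_le a) hr hrv (p.1.parent_rootOf 0)
      (p.1.isDescendant_rootOf 0)
    have hpos := (p.1.attach p.2 (p.1.rootOf 0) hr hrv).numComponents_pos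
    simp only [edgeWeight, hi]
    rw [show n + 1 - (p.1.attach p.2 (p.1.rootOf 0) hr hrv).numComponents -
        (p.1.numImproper + 1) = n + 1 - p.1.numComponents - p.1.numImproper by omega,
      show (p.1.attach p.2 (p.1.rootOf 0) hr hrv).numComponents - 1 =
        p.1.numComponents - 2 by omega, pow_succ]
    congr 2
    ring

/-- The recurrence of the generating polynomials, in operator form. -/
theorem genPoly_succ_eq (n : ℕ) :
    genPoly y z (n + 1) = X * derivResolvent y (taylor z (genPoly y z n)) := by
  classical
  have h : reducedGenPoly y z n - C y * derivative (reducedGenPoly y z n) =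
      taylor z (genPoly y z n) := by
    rw [sub_eq_iff_eq_add, ← sum_parent_zero_eq_none, ← sum_parent_zero_ne_none]
    exact (Finset.sum_filter_add_sum_filter_not _ _ _).symm
  rw [genPoly_succ, ← h, derivResolvent_sub_derivative]

end RootedForest

/-! ### The production operators and their total positivity -/

section Production

open Polynomial RootedForest

variable {R : Type*} [CommRing R] {S : Subsemiring R} (x y z : R)

/-- A forest with as many components as vertices has no edges. -/
theorem forestCount_self (n : ℕ) : forestCount n n 0 = 1 := by
  rw [forestCount, Nat.card_eq_one_iff_unique]
  have hnone : ∀ F : RootedForest (Fin n), F.numComponents = n → ∀ j, F.parent j = none := by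
    intro F hF j
    rw [← RootedForest.card_roots] at hF
    have : F.roots = Finset.univ := Finset.eq_univ_of_card _ (by simpa using hF)
    exact mem_roots.1 (this ▸ Finset.mem_univ j)
  refine ⟨⟨?_⟩, ⟨⟨fun _ => none, fun j => ⟨j, rfl, .refl⟩⟩, ?_, ?_⟩⟩
  · rintro ⟨F, hF, _⟩ ⟨G, hG, _⟩
    ext j : 3
    rw [hnone F hF j, hnone G hG j]
  · simp [numComponents]
  · simp [numImproper, IsImproperEdge, IsEdge]

theorem forestPoly_self (n : ℕ) : forestPoly y z n n = 1 := by
  simp [forestPoly, forestCount_self]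

theorem genPoly_zero : genPoly y z 0 = 1 := by
  simp [genPoly_eq_sum_forestPoly, forestPoly_self]

/-- The operator `p ↦ (X + x) (1 - y d/dX)⁻¹ p(X + z)`, whose matrix is the production matrix of
the binomial row-generating matrix. -/
noncomputable def productionOp : R[X] →ₗ[R] R[X] :=
  LinearMap.mulLeft R (X + C x) ∘ₗ derivResolvent y ∘ₗ taylor z

theorem isTP_opMatrix_productionOp {x y z : R} (hx : x ∈ S) (hy : y ∈ S) (hz : z ∈ S) :
    IsTP S (opMatrix (productionOp x y z)) :=
  isTP_opMatrix_comp
    (isTP_opMatrix_comp (isTP_opMatrix_taylor hz) (isTP_opMatrix_derivResolvent hy))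
    (isTP_opMatrix_mulLeft_X_add_C hx)

theorem taylor_genPoly (n : ℕ) :
    taylor x (genPoly y z n) = (productionOp x y z)^[n] 1 := by
  induction n with
  | zero => simp [genPoly_zero]
  | succ n ih =>
    rw [Function.iterate_succ_apply', ← ih, genPoly_succ_eq, taylor_mul, taylor_X,
      ← derivResolvent_taylor, taylor_taylor, add_comm x z, ← taylor_taylor]
    rfl

theorem binomialRowMatrix_eq_coeff :
    binomialRowMatrix x y z = Matrix.of fun n k => ((productionOp x y z)^[n] 1).coeff k := by
  ext n k
  rw [Matrix.of_apply, ← taylor_genPoly, genPoly_eq_sum_forestPoly, map_sum, finsetSum_coeff,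
    binomialRowMatrix, Matrix.of_apply]
  simp only [taylor_mul, taylor_C, taylor_X_pow, coeff_C_mul, coeff_X_add_C_pow]
  refine (Finset.sum_congr rfl fun l _ => by ring).trans
    (Finset.sum_subset (s₁ := Finset.Icc k n) ?_ ?_)
  · intro l hl
    simp only [Finset.mem_Icc, Finset.mem_range] at hl ⊢
    omega
  · intro l hl hl'
    simp only [Finset.mem_Icc, Finset.mem_range] at hl hl'
    rw [Nat.choose_eq_zero_of_lt (by omega)]
    simp

theorem rowPoly_eq_coeff (n : ℕ) : rowPoly x y z n = ((productionOp x y z)^[n] 1).coeff 0 := by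
  rw [← taylor_genPoly, genPoly_eq_sum_forestPoly, taylor_coeff_zero, eval_finsetSum, rowPoly]
  simp

theorem isUnitLowerTriangular_binomialRowMatrix :
    IsUnitLowerTriangular (binomialRowMatrix x y z) := by
  refine ⟨fun n => ?_, fun n k h => ?_⟩
  · simp [binomialRowMatrix, forestPoly_self]
  · simp [binomialRowMatrix, Finset.Icc_eq_empty_of_lt h]

/-- The operator `p ↦ (1 - y d/dX)⁻¹ ((X + z) p(X + z))`. It is the case `x = 0` of the production
operator with multiplication by `X` moved to the right: its matrix is the production matrix with
its first row and column deleted. -/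
noncomputable def treeProductionOp : R[X] →ₗ[R] R[X] :=
  (derivResolvent y ∘ₗ taylor z) ∘ₗ LinearMap.mulLeft R (X + C 0)

theorem isTP_opMatrix_treeProductionOp {y z : R} (hy : y ∈ S) (hz : z ∈ S) :
    IsTP S (opMatrix (treeProductionOp y z)) :=
  isTP_opMatrix_comp (isTP_opMatrix_mulLeft_X_add_C (zero_mem S))
    (isTP_opMatrix_comp (isTP_opMatrix_taylor hz) (isTP_opMatrix_derivResolvent hy))

theorem genPoly_succ_eq_iterate (n : ℕ) :
    genPoly y z (n + 1) = X * (treeProductionOp y z)^[n] 1 := by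
  induction n with
  | zero =>
    have : derivResolvent y 1 = 1 := by
      simpa [derivResolventPoly] using derivResolvent_X_pow y 0
    rw [genPoly_succ_eq, genPoly_zero, taylor_one, C_1, this]
    rfl
  | succ n ih =>
    rw [genPoly_succ_eq, ih, Function.iterate_succ_apply']
    simp [treeProductionOp]

theorem forestPoly_succ_one (n : ℕ) :
    forestPoly y z (n + 1) 1 = ((treeProductionOp y z)^[n] 1).coeff 0 := by
  have h := congrArg (fun p => p.coeff 1) (genPoly_succ_eq_iterate y z n)
  simpa [genPoly_eq_sum_forestPoly, finsetSum_coeff, coeff_X_pow] using h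

end Production

/-! ### Coefficientwise total positivity -/

section Coefficientwise

variable {σ : Type*}

/-- The subsemiring of integer polynomials with nonnegative coefficients. -/
def coeffNonneg (σ : Type*) : Subsemiring (MvPolynomial σ ℤ) where
  carrier := {p | ∀ d, 0 ≤ p.coeff d}
  mul_mem' := fun {p q} hp hq d => by
    classical
    rw [MvPolynomial.coeff_mul]
    exact Finset.sum_nonneg fun e _ => mul_nonneg (hp _) (hq _)
  one_mem' := fun d => by
    classical
    rw [MvPolynomial.coeff_one]
    split_ifs <;> simp
  add_mem' := fun {p q} hp hq d => by
    rw [MvPolynomial.coeff_add]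
    exact add_nonneg (hp d) (hq d)
  zero_mem' := fun d => by simp

theorem X_mem_coeffNonneg (i : σ) : MvPolynomial.X i ∈ coeffNonneg σ := fun d => by
  classical
  rw [MvPolynomial.coeff_X]
  split_ifs <;> simp

theorem IsTP.coeffwiseTP {A : Matrix ℕ ℕ (MvPolynomial σ ℤ)} (h : IsTP (coeffNonneg σ) A) :
    CoeffwiseTP A :=
  fun r I J hI hJ d => h r I J hI hJ d

end Coefficientwise

/-- In (a) and (b) the indeterminates `x, y, z` are `X 0, X 1, X 2` in `ℤ[x,y,z]`; in (c) the
indeterminates `y, z` are `X 0, X 1` in `ℤ[y,z]`. -/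
theorem theorem1p3 :
    (IsUnitLowerTriangular
        (binomialRowMatrix (MvPolynomial.X 0 : MvPolynomial (Fin 3) ℤ)
          (MvPolynomial.X 1) (MvPolynomial.X 2)) ∧
      CoeffwiseTP
        (binomialRowMatrix (MvPolynomial.X 0 : MvPolynomial (Fin 3) ℤ)
          (MvPolynomial.X 1) (MvPolynomial.X 2))) ∧
    CoeffwiseHankelTP
      (fun n : ℕ => rowPoly (MvPolynomial.X 0 : MvPolynomial (Fin 3) ℤ)
        (MvPolynomial.X 1) (MvPolynomial.X 2) n) ∧
    CoeffwiseHankelTP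
      (fun n : ℕ => forestPoly (MvPolynomial.X 0 : MvPolynomial (Fin 2) ℤ)
        (MvPolynomial.X 1) (n + 1) 1) := by
  have hP := isTP_opMatrix_productionOp (X_mem_coeffNonneg (0 : Fin 3)) (X_mem_coeffNonneg 1)
    (X_mem_coeffNonneg 2)
  have hQ := isTP_opMatrix_treeProductionOp (X_mem_coeffNonneg (0 : Fin 2)) (X_mem_coeffNonneg 1)
  refine ⟨⟨isUnitLowerTriangular_binomialRowMatrix _ _ _, IsTP.coeffwiseTP ?_⟩,
    IsTP.coeffwiseTP ?_, IsTP.coeffwiseTP ?_⟩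
  · rw [binomialRowMatrix_eq_coeff]
    exact isTP_coeff_iterate hP
  · simp only [rowPoly_eq_coeff]
    exact isTP_hankel_iterate hP
  · simp only [forestPoly_succ_one]
    exact isTP_hankel_iterate hQ
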